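/- All automata are nondeterministic with finite state set and finite alphabet. A Büchi automaton (NBW) $\mathcal A=(\Sigma,S,I,\Delta,F)$ accepts an $\omega$-word $\alpha\in\Sigma^\omega$ if there is a run $\rho(0)\rho(1)\dots\in S^\omega$ with $\rho(0)\in I$, $\langle\rho(i),\alpha(i),\rho(i+1)\rangle\in\Delta$ for all $i\ge 0$, and some state of $F$ occurring infinitely often in $\rho$. Let $C_{\mathrm{NBW}}(\mathcal A)$ be the minimum number of states of an NBW accepting $\Sigma^\omega\setminus\mathcal L(\mathcal A)$, and let $C_{\mathrm{NBW}}(n)$ be the maximum of $C_{\mathrm{NBW}}(\mathcal A)$ over all NBWs $\mathcal A$ with $n$ states. For $n>1$ let $\mathcal{FB}_n$ be the full Büchi automaton with state set $S_n=\{s_0,\dots,s_{n-2},s_f\}$, initial states $s_0,\dots,s_{n-2}$ (the main states) and single final state $s_f$; that is, its alphabet is the set of all binary relations on $S_n$, and $\langle p,a,q\rangle\in\Delta$ iff $\langle p,q\rangle\in a$. For $1\le m<n$, a $Q(m)$-ranking for $\mathcal{FB}_n$ is a partial function $g:S_n\to\{0,1,\dots,2n-2\}$ that is defined at every main state and undefined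 at $s_f$, whose maximum value is $2m-1$, and that attains every odd number in $\{0,\dots,2m\}$. Let $L(n,m)$ be the number of $Q(m)$-rankings for $\mathcal{FB}_n$ and $L(n)=\max_{1\le m<n}L(n,m)$. Theorem. For every $n>1$, $$L(n)\le C_{\mathrm{NBW}}(\mathcal{FB}_n)\le C_{\mathrm{NBW}}(n).$$ Moreover $L(n)=\Omega((0.76n)^n)$; more precisely, $L(n)$ equals $(cn)^n$ up to a polynomial factor, where $c=0.7645$ to four decimal places: there are a real number $c$ with $|c-0.7645|<0.00005$ and a natural number $d$ such that for all $n>1$ $$n^{-d}\,(cn)^n\le L(n)\le n^{d}\,(cn)^n .$$ -/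

import Mathlib

open Filter Asymptotics

/-- A nondeterministic Büchi word automaton with alphabet `A` and state set `S`
(finiteness of `A` and of `S` is imposed where automata are used). -/
structure NBW (A S : Type) where
  /-- initial states -/
  init : Set S
  /-- transition relation: `trans p a q` means `⟨p, a, q⟩ ∈ Δ` -/
  trans : S → A → S → Prop
  /-- final states -/
  final : Set S

namespace NBW

variable {A S : Type}

/-- `ρ` is an infinite run of `M` over the `ω`-word `α`. -/
def IsRun (M : NBW A S) (α : ℕ → A) (ρ : ℕ → S) : Prop :=
  ρ 0 ∈ M.init ∧ ∀ i, M.trans (ρ i) (α i) (ρ (i + 1))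

/-- The set of states that occur infinitely often in `ρ`. -/
def infStates (ρ : ℕ → S) : Set S :=
  {q | ∃ᶠ i in atTop, ρ i = q}

/-- The `ω`-language of a Büchi automaton. -/
def language (M : NBW A S) : Set (ℕ → A) :=
  {α | ∃ ρ, M.IsRun α ρ ∧ (infStates ρ ∩ M.final).Nonempty}

/-- The numbers `k` such that some Büchi automaton with exactly `k` states accepts the complement
of the `ω`-language of `M`. -/
def complementSizes (M : NBW A S) : Set ℕ :=
  {k | ∃ (T : Type) (_ : Fintype T) (N : NBW A T),
    Fintype.card T = k ∧ N.language = M.languageᶜ}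

/-- The state complexity of complementing `M`: the minimum number of states of a Büchi automaton
that complements `M`. -/
noncomputable def complementComplexity (M : NBW A S) : ℕ∞ :=
  ⨅ k ∈ M.complementSizes, (k : ℕ∞)

/-- The state complexity of Büchi complementation: the maximum of `complementComplexity M` over
all Büchi automata `M` with `n` states (over arbitrary finite alphabets). -/
noncomputable def complementComplexityOfSize (n : ℕ) : ℕ∞ :=
  sSup {c | ∃ (A : Type) (_ : Finite A) (S : Type) (_ : Fintype S) (M : NBW A S),
    Fintype.card S = n ∧ c = M.complementComplexity}

/-- The full Büchi automaton with given initial and final states: its letters are all binary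
relations on the state set, and reading the letter `a` one can move from `p` to `q` iff
`⟨p, q⟩ ∈ a`. -/
def full (I F : Set S) : NBW (Set (S × S)) S where
  init := I
  trans p a q := (p, q) ∈ a
  final := F

/-- The state set of the automaton `FB n`: `some i`, for `i < n - 1`, is the main state `s_i`, and
`none` is the state `s_f`. For `n ≥ 1` it has `n` elements. -/
abbrev FBState (n : ℕ) : Type := Option (Fin (n - 1))

/-- The full Büchi automaton whose initial states are the `n - 1` main states and whose only final
state is `s_f`. -/
def FB (n : ℕ) : NBW (Set (FBState n × FBState n)) (FBState n) :=
  full (Set.range some) {none}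

/-- A level ranking for `M`, where `M` has `N` states: a partial function from the states to
`{0, …, 2N - 2}` that takes no odd value on a final state (`g q = none` means that `g` is undefined
at `q`). -/
def IsLevelRanking [Fintype S] (M : NBW A S) (g : S → Option ℕ) : Prop :=
  ∀ q r, g q = some r → r ≤ 2 * Fintype.card S - 2 ∧ (Odd r → q ∉ M.final)

/-- A tight level ranking with parameter `m ≥ 1`: the maximum rank is `2m - 1`, and every odd
number in `{0, …, 2m}` is attained. -/
def IsTightLevelRanking [Fintype S] (M : NBW A S) (m : ℕ) (g : S → Option ℕ) : Prop :=
  M.IsLevelRanking g ∧ 1 ≤ m ∧ IsGreatest {r | ∃ q, g q = some r} (2 * m - 1) ∧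
    ∀ j, j ≤ 2 * m → Odd j → ∃ q, g q = some j

/-- A `Q(m)`-ranking: a tight level ranking for `FB n` with parameter `m` which is defined at every
main state and undefined at `s_f`. -/
def IsQRanking (n m : ℕ) (g : FBState n → Option ℕ) : Prop :=
  (FB n).IsTightLevelRanking m g ∧ (∀ i, g (some i) ≠ none) ∧ g none = none

/-- `L(n, m)`: the number of `Q(m)`-rankings for `FB n`. -/
noncomputable def qRankingCount (n m : ℕ) : ℕ :=
  {g | IsQRanking n m g}.ncard

/-- `L(n)`: the maximum of `L(n, m)` over `1 ≤ m < n`. -/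
noncomputable def maxQRankingCount (n : ℕ) : ℕ :=
  (Finset.Ico 1 n).sup (qRankingCount n)

end NBW

/-!
Let `M` be the full automaton with main states `ι` (all initial) and one further state, which is the
only final one.

*Lower bound.* A ranking is a function `f : ι → ℕ` with values less than `2 * m` that attains all
odd ones. Two words belong to it. Over `u = rankWord f m` the automaton can move from `p` to `q` iff
`f q ≤ f p`, and it can visit the final state on the way iff `f q < f p` or `f p = f q` is even.
Over the letter `v = letterDown f` the rank has to decrease or to stay at an odd value. Hence
`(u^k v)^ω` is rejected for all `k` (`lasso_notMem_language`): along a run the rank is eventually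
constant, by the occurrences of `v` it is eventually odd, and then the final state is not visited.
An automaton `N` for the complement accepts this word. If `k` is larger than the number of states of
`N`, an accepting run repeats a state within a block `u^k`, and infinitely often the repeated state
is the same `t` (`exists_pumping_state`). So `t` lies on a cycle of `N` through a final state whose
word is built from copies of `u` and `v`, and on a cycle whose word is a power of `u`.

If rankings `f` and `g` give the same state `t`, then `N` accepts the ultimately periodic word whose
period is the first cycle for `f` followed by the second cycle for `g`. If two main states are
compared differently by `f` and `g`, or a main state has odd rank in `f` and even rank in `g`, this
word (or that with `f` and `g` exchanged) is accepted by `M` (`Conflict.lasso_mem_language`), which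
is impossible. Otherwise `f` and `g` induce the same order and the same parities, and since both
attain precisely the same odd numbers, `f = g` (`IsTight.eq_of_not_conflict`). So `N` has at least
as many states as there are rankings.

*Growth.* With `N = n - 1`, inclusion–exclusion over the odd values shows that
`L(n, m) = N ! * [X ^ N] (exp (2 * X) - exp X) ^ m` (`ncard_isTight`). Put `ρ = log φ`, with the
golden ratio `φ`; since `φ ^ 2 - φ = 1`, the series `exp (2 * X) - exp X` takes the value `1` at `ρ`.
Thus its coefficients, weighted by the powers of `ρ`, form a probability distribution. This
bounds each `L(n, m)` by `N ! / ρ ^ N` (`rankCoeff_mul_pow_le_one`); and the coefficients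
of the sum over `m` satisfy a renewal inequality, which bounds their products with
`ρ ^ N` below by the reciprocal of a polynomial in `N` (`le_rankCoeffSum_mul_pow`). As the maximum over `m` is at least the
average, Stirling-type bounds for `N !` give the constant `c = 1 / (exp 1 * log φ) = 0.76448…`.
-/

namespace NBW

/-! ### Finite paths and lasso words -/

section Paths

variable {A S : Type}

/-- `M.Path w p q`: the automaton `M` can move from `p` to `q` reading the finite word `w`. -/
def Path (M : NBW A S) : List A → S → S → Prop
  | [], p, q => p = q
  | a :: w, p, q => ∃ r, M.trans p a r ∧ M.Path w r q

/-- `M.FPath w p q`: the automaton `M` can move from `p` to `q` reading the finite word `w` in such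
a way that a final state occurs on the path; the last state `q` does not count. -/
def FPath (M : NBW A S) : List A → S → S → Prop
  | [], _, _ => False
  | a :: w, p, q => ∃ r, M.trans p a r ∧ ((p ∈ M.final ∧ M.Path w r q) ∨ M.FPath w r q)

variable {M : NBW A S}

@[simp] lemma path_nil {p q : S} : M.Path [] p q ↔ p = q := Iff.rfl

@[simp] lemma path_cons {a : A} {w : List A} {p q : S} :
    M.Path (a :: w) p q ↔ ∃ r, M.trans p a r ∧ M.Path w r q := Iff.rfl

@[simp] lemma fpath_nil {p q : S} : ¬ M.FPath [] p q := fun h => h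

@[simp] lemma fpath_cons {a : A} {w : List A} {p q : S} :
    M.FPath (a :: w) p q ↔
      ∃ r, M.trans p a r ∧ ((p ∈ M.final ∧ M.Path w r q) ∨ M.FPath w r q) := Iff.rfl

lemma path_append {w₁ w₂ : List A} {p q : S} :
    M.Path (w₁ ++ w₂) p q ↔ ∃ r, M.Path w₁ p r ∧ M.Path w₂ r q := by
  induction w₁ generalizing p with
  | nil => simp
  | cons a w ih =>
    simp only [List.cons_append, path_cons, ih]
    constructor
    · rintro ⟨r, hr, s, h₁, h₂⟩
      exact ⟨s, ⟨r, hr, h₁⟩, h₂⟩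
    · rintro ⟨s, ⟨r, hr, h₁⟩, h₂⟩
      exact ⟨r, hr, s, h₁, h₂⟩

lemma fpath_append {w₁ w₂ : List A} {p q : S} :
    M.FPath (w₁ ++ w₂) p q ↔
      ∃ r, (M.FPath w₁ p r ∧ M.Path w₂ r q) ∨ (M.Path w₁ p r ∧ M.FPath w₂ r q) := by
  induction w₁ generalizing p with
  | nil => simp
  | cons a w ih =>
    simp only [List.cons_append, path_cons, fpath_cons, ih, path_append]
    constructor
    · rintro ⟨r, hr, ⟨hp, s, h₁, h₂⟩ | ⟨s, ⟨h₁, h₂⟩ | ⟨h₁, h₂⟩⟩⟩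
      · exact ⟨s, .inl ⟨⟨r, hr, .inl ⟨hp, h₁⟩⟩, h₂⟩⟩
      · exact ⟨s, .inl ⟨⟨r, hr, .inr h₁⟩, h₂⟩⟩
      · exact ⟨s, .inr ⟨⟨r, hr, h₁⟩, h₂⟩⟩
    · rintro ⟨s, ⟨⟨r, hr, ⟨hp, h₁⟩ | h₁⟩, h₂⟩ | ⟨⟨r, hr, h₁⟩, h₂⟩⟩
      · exact ⟨r, hr, .inl ⟨hp, s, h₁, h₂⟩⟩
      · exact ⟨r, hr, .inr ⟨s, .inl ⟨h₁, h₂⟩⟩⟩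
      · exact ⟨r, hr, .inr ⟨s, .inr ⟨h₁, h₂⟩⟩⟩

lemma Path.append {w₁ w₂ : List A} {p q r : S} (h₁ : M.Path w₁ p r) (h₂ : M.Path w₂ r q) :
    M.Path (w₁ ++ w₂) p q := path_append.2 ⟨r, h₁, h₂⟩

lemma FPath.append_path {w₁ w₂ : List A} {p q r : S} (h₁ : M.FPath w₁ p r) (h₂ : M.Path w₂ r q) :
    M.FPath (w₁ ++ w₂) p q := fpath_append.2 ⟨r, .inl ⟨h₁, h₂⟩⟩

lemma Path.append_fpath {w₁ w₂ : List A} {p q r : S} (h₁ : M.Path w₁ p r) (h₂ : M.FPath w₂ r q) :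
    M.FPath (w₁ ++ w₂) p q := fpath_append.2 ⟨r, .inr ⟨h₁, h₂⟩⟩

lemma path_of_run {w : List A} {ρ : ℕ → S}
    (h : ∀ i (hi : i < w.length), M.trans (ρ i) w[i] (ρ (i + 1))) :
    M.Path w (ρ 0) (ρ w.length) := by
  induction w generalizing ρ with
  | nil => rfl
  | cons a w ih =>
    refine ⟨ρ 1, h 0 (by simp), ?_⟩
    exact ih (ρ := fun i => ρ (i + 1)) fun i hi => h (i + 1) (by simpa using hi)

lemma fpath_of_run {w : List A} {ρ : ℕ → S}
    (h : ∀ i (hi : i < w.length), M.trans (ρ i) w[i] (ρ (i + 1)))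
    {j : ℕ} (hj : j < w.length) (hF : ρ j ∈ M.final) :
    M.FPath w (ρ 0) (ρ w.length) := by
  induction w generalizing ρ j with
  | nil => simp at hj
  | cons a w ih =>
    have h' : ∀ i (hi : i < w.length), M.trans (ρ (i + 1)) w[i] (ρ (i + 1 + 1)) :=
      fun i hi => h (i + 1) (by simpa using hi)
    refine ⟨ρ 1, h 0 (by simp), ?_⟩
    cases j with
    | zero => exact .inl ⟨hF, path_of_run (ρ := fun i => ρ (i + 1)) h'⟩
    | succ j => exact .inr (ih (ρ := fun i => ρ (i + 1)) h' (by simpa using hj) hF)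

lemma Path.exists_run {w : List A} {p q : S} (h : M.Path w p q) :
    ∃ ρ : ℕ → S, ρ 0 = p ∧ ρ w.length = q ∧
      ∀ i (hi : i < w.length), M.trans (ρ i) w[i] (ρ (i + 1)) := by
  induction w generalizing p with
  | nil => exact ⟨fun _ => p, rfl, h, fun i hi => by simp at hi⟩
  | cons a w ih =>
    obtain ⟨r, hr, h⟩ := h
    obtain ⟨ρ, h0, h1, hρ⟩ := ih h
    refine ⟨fun i => i.casesOn p ρ, rfl, h1, ?_⟩
    rintro (_ | i) hi
    · simpa [h0] using hr
    · exact hρ i (by simpa using hi)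

lemma FPath.exists_run {w : List A} {p q : S} (h : M.FPath w p q) :
    ∃ ρ : ℕ → S, ρ 0 = p ∧ ρ w.length = q ∧
      (∀ i (hi : i < w.length), M.trans (ρ i) w[i] (ρ (i + 1))) ∧
      ∃ j < w.length, ρ j ∈ M.final := by
  induction w generalizing p with
  | nil => exact h.elim
  | cons a w ih =>
    obtain ⟨r, hr, ⟨hp, h⟩ | h⟩ := h
    · obtain ⟨ρ, h0, h1, hρ⟩ := h.exists_run
      refine ⟨fun i => i.casesOn p ρ, rfl, h1, ?_, 0, by simp, hp⟩
      rintro (_ | i) hi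
      · simpa [h0] using hr
      · exact hρ i (by simpa using hi)
    · obtain ⟨ρ, h0, h1, hρ, j, hj, hF⟩ := ih h
      refine ⟨fun i => i.casesOn p ρ, rfl, h1, ?_, j + 1, by simpa using hj, hF⟩
      rintro (_ | i) hi
      · simpa [h0] using hr
      · exact hρ i (by simpa using hi)

/-- The ultimately periodic word `x yyy…`; it is meaningful for `y ≠ []`. -/
def lasso [Inhabited A] (x y : List A) (k : ℕ) : A :=
  if k < x.length then x[k]! else y[(k - x.length) % y.length]!

variable [Inhabited A]

lemma lasso_mem_language {x y : List A} {p q : S} (hp : p ∈ M.init) (hx : M.Path x p q)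
    (hy : M.FPath y q q) : lasso x y ∈ M.language := by
  obtain ⟨ρ, h0, h1, hρ⟩ := hx.exists_run
  obtain ⟨σ, g0, g1, hσ, j, hj, hF⟩ := hy.exists_run
  have hL : 0 < y.length := by omega
  refine ⟨fun k => if k < x.length then ρ k else σ ((k - x.length) % y.length), ⟨?_, ?_⟩,
    σ j, ?_, hF⟩
  · by_cases h : 0 < x.length
    · simpa [h, h0] using hp
    · have : x.length = 0 := by omega
      rw [this, h0] at h1
      simpa [h, g0, h1] using hp
  · intro k
    by_cases hk : k < x.length
    · have := hρ k hk
      simp only [lasso, hk, if_true, getElem!_pos]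
      by_cases hk' : k + 1 < x.length
      · simpa [hk'] using this
      · have e : k + 1 = x.length := by omega
        simpa [e, g0, h1] using this
    · have hk' : ¬ k + 1 < x.length := by omega
      simp only [lasso, hk, hk', if_false]
      obtain ⟨l, rfl⟩ : ∃ l, k = x.length + l := ⟨k - x.length, by omega⟩
      have e : x.length + l + 1 - x.length = l + 1 := by omega
      rw [e, Nat.add_sub_cancel_left]
      have hlt := Nat.mod_lt l hL
      rw [getElem!_pos y _ hlt]
      have := hσ _ hlt
      have hmod : (l + 1) % y.length = (l % y.length + 1) % y.length := by simp
      rw [hmod]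
      by_cases hw : l % y.length + 1 < y.length
      · rwa [Nat.mod_eq_of_lt hw]
      · have e' : l % y.length + 1 = y.length := by omega
        rw [e', g1] at this
        rwa [e', Nat.mod_self, g0]
  · refine frequently_atTop.2 fun a => ⟨x.length + (a * y.length + j), ?_, ?_⟩
    · nlinarith
    · simp [Nat.mod_eq_of_lt hj]

/-- An accepting run over `yyy…`, observed after each copy of `y`. -/
lemma exists_of_lasso_mem_language {y : List A} (hy : y ≠ []) (h : lasso [] y ∈ M.language) :
    ∃ r : ℕ → S, r 0 ∈ M.init ∧ (∀ n, M.Path y (r n) (r (n + 1))) ∧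
      ∃ᶠ n in atTop, M.FPath y (r n) (r (n + 1)) := by
  obtain ⟨ρ, ⟨h0, hρ⟩, q, hq, hF⟩ := h
  have hL : 0 < y.length := List.length_pos_iff.2 hy
  have key : ∀ n i (hi : i < y.length),
      M.trans (ρ (n * y.length + i)) y[i] (ρ (n * y.length + (i + 1))) := by
    intro n i hi
    have := hρ (n * y.length + i)
    simpa [lasso, Nat.mod_eq_of_lt hi, hi, add_assoc] using this
  have e : ∀ n, (n + 1) * y.length = n * y.length + y.length := fun n => by ring
  refine ⟨fun n => ρ (n * y.length), by simpa using h0, fun n => ?_, ?_⟩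
  · have := path_of_run (ρ := fun i => ρ (n * y.length + i)) (key n)
    simpa [e] using this
  · refine frequently_atTop.2 fun a => ?_
    obtain ⟨i, hi, hiq⟩ := frequently_atTop.1 hq (a * y.length)
    refine ⟨i / y.length, (Nat.le_div_iff_mul_le hL).2 hi, ?_⟩
    have := fpath_of_run (ρ := fun j => ρ (i / y.length * y.length + j)) (key (i / y.length))
      (Nat.mod_lt i hL) (by
        simpa [Nat.div_add_mod', hiq] using hF)
    simpa [e] using this

end Paths

/-! ### Pumping in an automaton that accepts `(u^k v)^ω` -/

section Pumping

variable {A S : Type} {M : NBW A S}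

/-- The word `w` repeated `k` times. -/
def wpow (w : List A) (k : ℕ) : List A := (List.replicate k w).flatten

@[simp] lemma wpow_zero (w : List A) : wpow w 0 = [] := by simp [wpow]

lemma wpow_succ (w : List A) (k : ℕ) : wpow w (k + 1) = w ++ wpow w k := by
  simp [wpow, List.replicate_succ]

lemma wpow_succ' (w : List A) (k : ℕ) : wpow w (k + 1) = wpow w k ++ w := by
  simp [wpow, List.replicate_succ']

lemma path_wpow_of_chain {w : List A} {r : ℕ → S} {a b : ℕ} (hab : a ≤ b)
    (h : ∀ n, a ≤ n → n < b → M.Path w (r n) (r (n + 1))) :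
    M.Path (wpow w (b - a)) (r a) (r b) := by
  induction b, hab using Nat.le_induction with
  | base => simp
  | succ b hab ih =>
    rw [Nat.succ_sub hab, wpow_succ']
    exact (ih fun n h₁ h₂ => h n h₁ (by omega)).append (h b hab (by omega))

lemma Path.exists_chain {w : List A} {k : ℕ} {p q : S} (h : M.Path (wpow w k) p q) :
    ∃ s : ℕ → S, s 0 = p ∧ s k = q ∧ ∀ i < k, M.Path w (s i) (s (i + 1)) := by
  induction k generalizing q with
  | zero => exact ⟨fun _ => p, rfl, by simpa using h, by simp⟩
  | succ k ih =>
    rw [wpow_succ', path_append] at h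
    obtain ⟨r, h₁, h₂⟩ := h
    obtain ⟨s, h0, hk, hs⟩ := ih h₁
    refine ⟨fun i => if i ≤ k then s i else q, by simpa using h0, by simp, fun i hi => ?_⟩
    rcases Nat.lt_or_ge i k with hik | hik
    · have : i + 1 ≤ k := hik
      simpa [hik.le, this] using hs i hik
    · obtain rfl : i = k := by omega
      simpa [hk] using h₂

/-- On a path over `u^k` with `k` larger than the number of states, some state is the beginning and
the end of a segment over a positive power of `u`; this segment may be chosen not to begin at the
beginning, nor to end at the end, of the path. -/
lemma Path.exists_loop [Fintype S] {u : List A} {p q : S}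
    (h : M.Path (wpow u (Fintype.card S + 2)) p q) :
    ∃ t i c e, M.Path (wpow u (i + 1)) p t ∧ M.Path (wpow u (c + 1)) t t ∧
      M.Path (wpow u (e + 1)) t q := by
  obtain ⟨s, h0, hk, hs⟩ := h.exists_chain
  obtain ⟨i, j, hij, hst⟩ : ∃ i j : Fin (Fintype.card S + 1), i < j ∧ s (i + 1) = s (j + 1) := by
    obtain ⟨i, j, hne, hst⟩ := Fintype.exists_ne_map_eq_of_card_lt
      (fun i : Fin (Fintype.card S + 1) => s (i + 1)) (by simp)
    rcases lt_or_gt_of_ne hne with h | h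
    · exact ⟨i, j, h, hst⟩
    · exact ⟨j, i, h, hst.symm⟩
  have hij' : (i : ℕ) < j := hij
  have hj := j.isLt
  refine ⟨s (i + 1), i, j - i - 1, Fintype.card S - i, ?_, ?_, ?_⟩
  · have := path_wpow_of_chain (M := M) (w := u) (r := s) (Nat.zero_le (i + 1))
      fun n _ h₂ => hs n (by omega)
    rwa [h0] at this
  · have := path_wpow_of_chain (M := M) (w := u) (r := s) (a := i + 1) (b := j + 1) (by omega)
      fun n _ h₂ => hs n (by omega)
    rw [← hst] at this
    convert this using 2
    omega
  · have := path_wpow_of_chain (M := M) (w := u) (r := s) (a := i + 1) (b := Fintype.card S + 2)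
      (by omega) fun n _ h₂ => hs n (by omega)
    rw [hk] at this
    convert this using 2
    omega

/-- If `M` accepts `(u^k v)^ω` with `k` larger than the number of states of `M`, then some state
`t` is reachable from an initial state, lies on a cycle through a final state, and lies on a cycle
labelled by a power of `u`. The words of the access path and of the first cycle are products of
copies of `u` and `v` (expressed by a property `C` which such products have); the access path ends,
and the cycle begins and ends, with a copy of `u`. -/
lemma exists_pumping_state [Fintype S] [Inhabited A] {u v : List A} (C : List A → Prop)
    (hnil : C []) (hu : C u) (hv : C v) (happ : ∀ x y, C x → C y → C (x ++ y)) (hv0 : v ≠ [])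
    (h : lasso [] (wpow u (Fintype.card S + 2) ++ v) ∈ M.language) :
    ∃ t, (∃ p ∈ M.init, ∃ x, C x ∧ M.Path (x ++ u) p t) ∧
      (∃ z, C z ∧ M.FPath (u ++ z ++ u) t t) ∧ ∃ c, M.Path (wpow u (c + 1)) t t := by
  have hpow : ∀ w k, C w → C (wpow w k) := by
    intro w k hw
    induction k with
    | zero => simpa using hnil
    | succ k ih => rw [wpow_succ]; exact happ _ _ hw ih
  set y := wpow u (Fintype.card S + 2) ++ v with hy
  have hCy : C y := happ _ _ (hpow _ _ hu) hv
  obtain ⟨r, hr0, hr, hF⟩ := exists_of_lasso_mem_language (by simp [hy, hv0]) h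
  have hloop : ∀ n, ∃ t i c e, M.Path (wpow u (i + 1)) (r n) t ∧ M.Path (wpow u (c + 1)) t t ∧
      M.Path (wpow u (e + 1) ++ v) t (r (n + 1)) := by
    intro n
    obtain ⟨s, h₁, h₂⟩ := path_append.1 (hr n)
    obtain ⟨t, i, c, e, h₃, h₄, h₅⟩ := h₁.exists_loop
    exact ⟨t, i, c, e, h₃, h₄, h₅.append h₂⟩
  choose τ i c e h₁ h₂ h₃ using hloop
  obtain ⟨t, ht⟩ := Finite.exists_infinite_fiber τ
  have hinf : (τ ⁻¹' {t}).Infinite := Set.infinite_coe_iff.1 ht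
  obtain ⟨a, ha : τ a = t, -⟩ := hinf.exists_gt 0
  obtain ⟨b, hab, hb⟩ := frequently_atTop.1 hF (a + 1)
  obtain ⟨d, hd : τ d = t, hbd⟩ := hinf.exists_gt b
  refine ⟨t, ⟨r 0, hr0, wpow y a ++ wpow u (i a), happ _ _ (hpow _ _ hCy) (hpow _ _ hu), ?_⟩,
    ⟨wpow u (e a) ++ v ++ (wpow y (b - (a + 1)) ++ y ++ wpow y (d - (b + 1))) ++ wpow u (i d),
      ?_, ?_⟩, c a, ha ▸ h₂ a⟩
  · rw [List.append_assoc, ← wpow_succ', ← ha]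
    exact (path_wpow_of_chain (Nat.zero_le a) fun n _ _ => hr n).append (h₁ a)
  · refine happ _ _ (happ _ _ (happ _ _ (hpow _ _ hu) hv) ?_) (hpow _ _ hu)
    exact happ _ _ (happ _ _ (hpow _ _ hCy) hCy) (hpow _ _ hCy)
  · have hmid : M.FPath (wpow y (b - (a + 1)) ++ y ++ wpow y (d - (b + 1))) (r (a + 1)) (r d) :=
      ((path_wpow_of_chain hab fun n _ _ => hr n).append_fpath hb).append_path
        (path_wpow_of_chain hbd fun n _ _ => hr n)
    have := ((h₃ a).append_fpath hmid).append_path (h₁ d)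
    rw [ha, hd, wpow_succ, wpow_succ'] at this
    simpa [List.append_assoc] using this

end Pumping

/-! ### The words of a ranking over the full automaton -/

section Rankings

variable {ι : Type}

/-- The full automaton on the main states `some p` and the final state `none`, with the main states
as initial states. -/
abbrev fullOption (ι : Type) : NBW (Set (Option ι × Option ι)) (Option ι) :=
  full (Set.range some) {none}

/-- The letter that allows moves between main states along which `f` does not increase, and moves
to the final state from the main states of rank at least `2 * i`. -/
def letterOut (f : ι → ℕ) (i : ℕ) : Set (Option ι × Option ι) :=
  {e | match e with
    | (some p, some q) => f q ≤ f p
    | (some p, none) => 2 * i ≤ f p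
    | _ => False}

/-- The letter that allows moves between main states along which `f` does not increase, and moves
from the final state to the main states of rank at most `2 * i`. -/
def letterIn (f : ι → ℕ) (i : ℕ) : Set (Option ι × Option ι) :=
  {e | match e with
    | (some p, some q) => f q ≤ f p
    | (none, some q) => f q ≤ 2 * i
    | _ => False}

/-- The letter that allows moves between main states along which `f` decreases, or is constant with
an odd value. -/
def letterDown (f : ι → ℕ) : Set (Option ι × Option ι) :=
  {e | match e with
    | (some p, some q) => f q < f p ∨ f q = f p ∧ Odd (f p)
    | _ => False}

/-- A word over which the automaton moves from the main state `p` to the main state `q` iff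
`f q ≤ f p`, and can do so through the final state iff `f q < f p` or `f q = f p` is even
(for `0 < m` and `f < 2 * m`). -/
def rankWord (f : ι → ℕ) : ℕ → List (Set (Option ι × Option ι))
  | 0 => []
  | m + 1 => rankWord f m ++ [letterOut f m, letterIn f m]

@[simp] lemma full_trans {S : Type} {I F : Set S} {p q : S} {a : Set (S × S)} :
    (full I F).trans p a q ↔ (p, q) ∈ a := Iff.rfl

variable {f g : ι → ℕ} {m : ℕ}

@[simp] lemma none_mem_final : none ∈ (fullOption ι).final := rfl

@[simp] lemma some_notMem_final {p : ι} : some p ∉ (fullOption ι).final := by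
  simp [fullOption, full]

/-- Along every path over `w` that begins in a main state and does not get stuck, `f` does not
increase, and it does decrease or is constant with an even value if the final state is visited. -/
def Sound (f : ι → ℕ) (w : List (Set (Option ι × Option ι))) : Prop :=
  ∀ p s, ((fullOption ι).Path w (some p) s → ∃ q, s = some q ∧ f q ≤ f p) ∧
    ((fullOption ι).FPath w (some p) s →
      ∃ q, s = some q ∧ (f q < f p ∨ f q = f p ∧ Even (f p)))

lemma sound_nil : Sound f [] := by
  intro p s
  refine ⟨?_, by simp⟩
  rintro rfl
  exact ⟨p, rfl, le_rfl⟩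

lemma Sound.append {w₁ w₂ : List (Set (Option ι × Option ι))} (h₁ : Sound f w₁)
    (h₂ : Sound f w₂) : Sound f (w₁ ++ w₂) := by
  intro p s
  simp only [path_append, fpath_append]
  constructor
  · rintro ⟨r, hr, hs⟩
    obtain ⟨q, rfl, hq⟩ := (h₁ p r).1 hr
    obtain ⟨q', rfl, hq'⟩ := (h₂ q s).1 hs
    exact ⟨q', rfl, hq'.trans hq⟩
  · rintro ⟨r, ⟨hr, hs⟩ | ⟨hr, hs⟩⟩
    · obtain ⟨q, rfl, hq⟩ := (h₁ p r).2 hr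
      obtain ⟨q', rfl, hq'⟩ := (h₂ q s).1 hs
      refine ⟨q', rfl, ?_⟩
      grind
    · obtain ⟨q, rfl, hq⟩ := (h₁ p r).1 hr
      obtain ⟨q', rfl, hq'⟩ := (h₂ q s).2 hs
      refine ⟨q', rfl, ?_⟩
      grind

lemma Sound.wpow {w : List (Set (Option ι × Option ι))} (h : Sound f w) (k : ℕ) :
    Sound f (wpow w k) := by
  induction k with
  | zero => simpa using sound_nil
  | succ k ih => rw [wpow_succ]; exact h.append ih

lemma sound_rankWord : Sound f (rankWord f m) := by
  induction m with
  | zero => exact sound_nil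
  | succ m ih =>
    refine ih.append fun p s => ⟨?_, ?_⟩
    · rintro ⟨r, hr, t, ht, rfl⟩
      rcases r with _ | r <;> rcases t with _ | t <;>
        simp [letterOut, letterIn] at hr ht <;> exact ⟨t, rfl, by omega⟩
    · rintro ⟨r, hr, ⟨h, -⟩ | ⟨t, ht, ⟨h, rfl⟩ | h⟩⟩
      · exact absurd h some_notMem_final
      · rcases r with _ | r
        · rcases t with _ | t <;> simp [letterOut, letterIn] at hr ht
          refine ⟨t, rfl, ?_⟩
          rcases (ht.trans hr).lt_or_eq with h | h
          · exact .inl h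
          · exact .inr ⟨h, m, by omega⟩
        · exact absurd h some_notMem_final
      · exact h.elim

lemma path_letterDown {p : ι} {s : Option ι} (h : (fullOption ι).Path [letterDown f] (some p) s) :
    ∃ q, s = some q ∧ (f q < f p ∨ f q = f p ∧ Odd (f p)) := by
  obtain ⟨r, hr, rfl⟩ := h
  rcases r with _ | r
  · simp [letterDown] at hr
  · exact ⟨r, rfl, hr⟩

lemma path_rankWord_refl (p : ι) : (fullOption ι).Path (rankWord f m) (some p) (some p) := by
  induction m with
  | zero => rfl
  | succ m ih => exact ih.append ⟨some p, by simp [letterOut], some p, by simp [letterIn], rfl⟩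

lemma path_rankWord {p q : ι} (hm : 0 < m) (h : f q ≤ f p) :
    (fullOption ι).Path (rankWord f m) (some p) (some q) := by
  obtain ⟨m, rfl⟩ : ∃ k, m = k + 1 := ⟨m - 1, by omega⟩
  exact (path_rankWord_refl p).append
    ⟨some q, by simpa [letterOut] using h, some q, by simp [letterIn], rfl⟩

lemma fpath_rankWord {p q : ι} {i : ℕ} (hi : i < m) (hp : 2 * i ≤ f p) (hq : f q ≤ 2 * i) :
    (fullOption ι).FPath (rankWord f m) (some p) (some q) := by
  induction m with
  | zero => omega
  | succ m ih =>
    rcases Nat.lt_succ_iff_lt_or_eq.1 hi with h | rfl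
    · exact (ih h).append_path ⟨some q, by simp [letterOut], some q, by simp [letterIn], rfl⟩
    · exact (path_rankWord_refl p).append_fpath
        ⟨none, by simpa [letterOut] using hp, .inr ⟨some q, by simpa [letterIn] using hq,
          .inl ⟨none_mem_final, rfl⟩⟩⟩

lemma fpath_rankWord_of_lt {p q : ι} (hp : f p < 2 * m) (h : f q < f p) :
    (fullOption ι).FPath (rankWord f m) (some p) (some q) :=
  fpath_rankWord (i := (f q + 1) / 2) (by omega) (by omega) (by omega)

lemma fpath_rankWord_of_even {p : ι} (hp : f p < 2 * m) (h : Even (f p)) :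
    (fullOption ι).FPath (rankWord f m) (some p) (some p) := by
  obtain ⟨k, hk⟩ := h
  exact fpath_rankWord (i := k) (by omega) (by omega) (by omega)

/-- In each period the rank of the current state decreases strictly if the final state is visited:
a visit with constant rank would need an even rank, and `letterDown` does not allow that. -/
lemma lasso_notMem_language (f : ι → ℕ) (m k : ℕ) :
    lasso [] (wpow (rankWord f m) k ++ [letterDown f]) ∉ (fullOption ι).language := by
  intro h
  obtain ⟨r, ⟨p₀, hp₀⟩, hr, hF⟩ := exists_of_lasso_mem_language (by simp) h
  have hs : Sound f (wpow (rankWord f m) k) := sound_rankWord.wpow k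
  have hmain : ∀ n, ∃ p, r n = some p := by
    intro n
    induction n with
    | zero => exact ⟨p₀, hp₀.symm⟩
    | succ n ih =>
      obtain ⟨p, hp⟩ := ih
      obtain ⟨s, h₁, h₂⟩ := path_append.1 (hr n)
      rw [hp] at h₁
      obtain ⟨q, rfl, -⟩ := (hs _ _).1 h₁
      obtain ⟨q', h, -⟩ := path_letterDown h₂
      exact ⟨q', h⟩
  choose p hp using hmain
  simp only [hp] at hr hF
  have hanti : Antitone fun n => f (p n) := by
    refine antitone_nat_of_succ_le fun n => ?_
    obtain ⟨s, h₁, h₂⟩ := path_append.1 (hr n)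
    obtain ⟨q, rfl, hq⟩ := (hs _ _).1 h₁
    obtain ⟨q', h, hq'⟩ := path_letterDown h₂
    obtain rfl := Option.some_injective _ h
    omega
  have hdecr : ∀ n, (fullOption ι).FPath (wpow (rankWord f m) k ++ [letterDown f]) (some (p n))
      (some (p (n + 1))) → f (p (n + 1)) < f (p n) := by
    intro n h
    obtain ⟨s, ⟨h₁, h₂⟩ | ⟨h₁, h₂⟩⟩ := fpath_append.1 h
    · obtain ⟨q, rfl, hq⟩ := (hs _ _).2 h₁
      obtain ⟨q', h, hq'⟩ := path_letterDown h₂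
      obtain rfl := Option.some_injective _ h
      grind
    · obtain ⟨q, rfl, hq⟩ := (hs _ _).1 h₁
      simp at h₂
  obtain ⟨n, hn⟩ := WellFoundedGT.monotone_chain_condition (α := ℕᵒᵈ)
    ⟨fun n => OrderDual.toDual (f (p n)), fun a b h => hanti h⟩
  obtain ⟨b, hb, hFb⟩ := frequently_atTop.1 hF n
  have h₁ := hn b hb
  have h₂ := hn (b + 1) (by omega)
  have h₃ := hdecr b hFb
  have h₄ : f (p n) = f (p b) := h₁
  have h₅ : f (p n) = f (p (b + 1)) := h₂
  omega

end Rankings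

/-! ### Different rankings need different states -/

section Separation

variable {ι : Type} {f g : ι → ℕ} {m : ℕ}

/-- The values of `f` are less than `2 * m`, and each odd number less than `2 * m` is a value. -/
def IsTight (f : ι → ℕ) (m : ℕ) : Prop :=
  (∀ p, f p < 2 * m) ∧ ∀ j < m, ∃ p, f p = 2 * j + 1

/-- Over a word that begins and ends with `rankWord f m`, and in between lets the main states of odd
rank stay where they are, all decreasing pairs are connected through the final state. A state of
even rank first moves to the odd rank below, which is attained as `f` is tight. -/
lemma IsTight.fpath_of_lt (hf : IsTight f m) {z : List (Set (Option ι × Option ι))}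
    (hz : ∀ p, Odd (f p) → (fullOption ι).Path z (some p) (some p)) {p q : ι} (h : f q < f p) :
    (fullOption ι).FPath (rankWord f m ++ z ++ rankWord f m) (some p) (some q) := by
  rcases Nat.even_or_odd (f p) with hp | hp
  · rcases Nat.even_or_odd (f q) with hq | hq
    · obtain ⟨a, ha⟩ := hp
      obtain ⟨b, hb⟩ := hq
      have := hf.1 p
      obtain ⟨r, hr⟩ := hf.2 (a - 1) (by omega)
      exact ((fpath_rankWord_of_lt (hf.1 p) (by omega)).append_path
        (hz r ⟨a - 1, hr⟩)).append_path (path_rankWord (by omega) (by omega))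
    · exact ((fpath_rankWord_of_lt (hf.1 p) h).append_path (hz q hq)).append_path
        (path_rankWord_refl q)
  · exact ((path_rankWord_refl p).append (hz p hp)).append_fpath
      (fpath_rankWord_of_lt (hf.1 p) h)

lemma IsTight.path_of_odd (hf : IsTight f m) {z : List (Set (Option ι × Option ι))}
    (hz : ∀ p, Odd (f p) → (fullOption ι).Path z (some p) (some p)) {p q : ι} (h : f p = f q)
    (hp : Odd (f p)) :
    (fullOption ι).Path (rankWord f m ++ z ++ rankWord f m) (some p) (some q) := by
  have := hf.1 p
  exact ((path_rankWord (by omega) h.ge).append (hz q (h ▸ hp))).append (path_rankWord_refl q)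

/-- The first condition on a pair of main states allows a path through the final state from `p` to
`q` in a cycle word for `f` (`IsTight.fpath_of_lt`) and some path from `q` back to `p` over
`rankWord g m`. The second allows some path from `p` to `q` in a cycle word for `f`
(`IsTight.path_of_odd`) and a path through the final state from `q` back to `p` over
`rankWord g m`. -/
def Conflict (f g : ι → ℕ) (p q : ι) : Prop :=
  (f q < f p ∧ g p ≤ g q) ∨ (f p = f q ∧ Odd (f p) ∧ (g p < g q ∨ p = q ∧ Even (g p)))

lemma path_wpow_rankWord_refl (c : ℕ) (p : ι) :
    (fullOption ι).Path (wpow (rankWord f m) c) (some p) (some p) := by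
  induction c with
  | zero => simp
  | succ c ih => rw [wpow_succ]; exact (path_rankWord_refl p).append ih

lemma Conflict.lasso_mem_language {p q : ι} (h : Conflict f g p q) (hf : IsTight f m)
    (hg : IsTight g m) {x z : List (Set (Option ι × Option ι))}
    (hx : ∀ p, Odd (f p) → (fullOption ι).Path x (some p) (some p))
    (hz : ∀ p, Odd (f p) → (fullOption ι).Path z (some p) (some p)) (c : ℕ) :
    lasso (x ++ rankWord f m) (rankWord f m ++ z ++ rankWord f m ++ wpow (rankWord g m) (c + 1)) ∈
      (fullOption ι).language := by
  have hp := hf.1 p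
  obtain ⟨p₀, hp₀⟩ := hf.2 (m - 1) (by omega)
  refine NBW.lasso_mem_language (p := some p₀) ⟨p₀, rfl⟩
    ((hx p₀ ⟨m - 1, hp₀⟩).append (path_rankWord (q := p) (by omega) (by omega))) ?_
  rw [wpow_succ]
  rcases h with ⟨h₁, h₂⟩ | ⟨h₁, h₂, h₃ | ⟨rfl, h₃⟩⟩
  · exact (hf.fpath_of_lt hz h₁).append_path
      ((path_rankWord (by omega) h₂).append (path_wpow_rankWord_refl c p))
  · exact (hf.path_of_odd hz h₁ h₂).append_fpath
      ((fpath_rankWord_of_lt (hg.1 q) h₃).append_path (path_wpow_rankWord_refl c p))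
  · exact (hf.path_of_odd hz h₁ h₂).append_fpath
      ((fpath_rankWord_of_even (hg.1 p) h₃).append_path (path_wpow_rankWord_refl c p))

/-- Without a conflict `f` and `g` induce the same strict order on the main states and have the same
states of odd rank. As they attain the same odd values, they are equal. -/
lemma IsTight.eq_of_not_conflict (hf : IsTight f m) (hg : IsTight g m)
    (h₁ : ∀ p q, ¬ Conflict f g p q) (h₂ : ∀ p q, ¬ Conflict g f p q) : f = g := by
  have hlt : ∀ p q, f q < f p ↔ g q < g p := by
    intro p q
    have a := h₁ p q
    have b := h₂ p q
    simp only [Conflict] at a b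
    constructor <;> intro h <;> by_contra! h' <;> tauto
  have hpar : ∀ p, Odd (f p) ↔ Odd (g p) := by
    intro p
    have a := h₁ p p
    have b := h₂ p p
    simp only [Conflict, ← Nat.not_odd_iff_even] at a b
    tauto
  have step : ∀ f g : ι → ℕ, IsTight f m → IsTight g m → (∀ p q, f q < f p ↔ g q < g p) →
      (∀ p, Odd (f p) ↔ Odd (g p)) → ∀ r, (∀ s < r, ∀ p, f p = s ↔ g p = s) →
      ∀ p, f p = r → g p = r := by
    intro f g hf hg hlt hpar r ih p hp
    have hge : r ≤ g p := by
      by_contra! h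
      exact h.ne' (hp.symm.trans ((ih _ h p).2 rfl))
    by_contra! hne
    have hpm := hf.1 p
    -- since `f p` and `g p` have the same parity, an odd value of `g` lies between them
    obtain ⟨j, hj₁, hj₂, hj₃⟩ : ∃ j, r ≤ 2 * j + 1 ∧ 2 * j + 1 < g p ∧ j < m := by
      rcases Nat.even_or_odd (f p) with h | h
      · have h' : ¬ Odd (g p) := by rw [← hpar, Nat.not_odd_iff_even]; exact h
        rw [Nat.not_odd_iff_even] at h'
        obtain ⟨a, ha⟩ := h
        obtain ⟨b, hb⟩ := h'
        exact ⟨a, by omega, by omega, by omega⟩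
      · obtain ⟨a, ha⟩ := h
        exact ⟨a, by omega, by omega, by omega⟩
    obtain ⟨q, hq⟩ := hg.2 j hj₃
    have h := (hlt p q).2 (hq ▸ hj₂)
    have := (ih (f q) (by omega) q).1 rfl
    omega
  have key : ∀ r p, f p = r ↔ g p = r := by
    intro r
    induction r using Nat.strong_induction_on with
    | _ r ih =>
      exact fun p => ⟨step f g hf hg hlt hpar r ih p,
        step g f hg hf (fun p q => (hlt p q).symm) (fun p => (hpar p).symm) r
          (fun s hs p => (ih s hs p).symm) p⟩
  exact funext fun p => ((key _ p).1 rfl).symm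

/-- Each tight `f` yields a word that the full automaton rejects, hence a pumping state of an
automaton for the complement. If `f` and `g` share this state, the automaton also accepts the words
that combine a cycle for `f` with one for `g`, so there is no conflict between `f` and `g`. -/
theorem ncard_isTight_le_card {T : Type} [Fintype T] {N : NBW (Set (Option ι × Option ι)) T}
    (hN : N.language = (fullOption ι).languageᶜ) (m : ℕ) :
    {f : ι → ℕ | IsTight f m}.ncard ≤ Fintype.card T := by
  have hpump : ∀ f : ι → ℕ, ∃ t,
      (∃ p ∈ N.init, ∃ x, (∀ p, Odd (f p) → (fullOption ι).Path x (some p) (some p)) ∧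
        N.Path (x ++ rankWord f m) p t) ∧
      (∃ z, (∀ p, Odd (f p) → (fullOption ι).Path z (some p) (some p)) ∧
        N.FPath (rankWord f m ++ z ++ rankWord f m) t t) ∧
      ∃ c, N.Path (wpow (rankWord f m) (c + 1)) t t := by
    intro f
    refine exists_pumping_state (v := [letterDown f])
      (fun w => ∀ p, Odd (f p) → (fullOption ι).Path w (some p) (some p))
      (fun _ _ => rfl) (fun p _ => path_rankWord_refl p) (fun p hp => ⟨some p, .inr ⟨rfl, hp⟩, rfl⟩)
      (fun x y hx hy p hp => (hx p hp).append (hy p hp)) (by simp) ?_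
    rw [hN]
    exact lasso_notMem_language f m _
  choose t hx hz hc using hpump
  have hconf : ∀ f g : ι → ℕ, IsTight f m → IsTight g m → t f = t g →
      ∀ p q, ¬ Conflict f g p q := by
    intro f g hf hg h p q hpq
    obtain ⟨p₀, hp₀, x, hxs, hxp⟩ := hx f
    obtain ⟨z, hzs, hzp⟩ := hz f
    obtain ⟨c, hcp⟩ := hc g
    have hmem := lasso_mem_language hp₀ hxp (hzp.append_path (h ▸ hcp))
    rw [hN] at hmem
    exact hmem (hpq.lasso_mem_language hf hg hxs hzs c)
  rw [← Nat.card_eq_fintype_card, ← Set.ncard_univ]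
  refine Set.ncard_le_ncard_of_injOn t (fun _ _ => Set.mem_univ _) fun f hf g hg h => ?_
  exact IsTight.eq_of_not_conflict hf hg (hconf f g hf hg h) (hconf g f hg hf h.symm)

end Separation

/-! ### `Q(m)`-rankings as tight functions on the main states -/

section QRankings

variable {n m : ℕ}

lemma setOf_isQRanking (hm : 1 ≤ m) (hmn : m < n) :
    {g | IsQRanking n m g} =
      (fun (f : Fin (n - 1) → ℕ) (s : FBState n) => s.map f) '' {f | IsTight f m} := by
  have hcard : Fintype.card (FBState n) = n := by simp; omega
  ext g
  simp only [Set.mem_ofPred_eq, Set.mem_image]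
  constructor
  · rintro ⟨⟨-, -, hmax, hodd⟩, hmain, hnone⟩
    have hg : ∀ s : FBState n, s.map (fun i => (g (some i)).getD 0) = g s := by
      rintro (_ | i)
      · simpa using hnone.symm
      · obtain ⟨r, hr⟩ := Option.ne_none_iff_exists'.1 (hmain i)
        simp [hr]
    refine ⟨fun i => (g (some i)).getD 0, ⟨fun i => ?_, fun j hj => ?_⟩, funext hg⟩
    · have := hmax.2 ⟨some i, (hg (some i)).symm⟩
      omega
    · obtain ⟨s, hs⟩ := hodd (2 * j + 1) (by omega) ⟨j, rfl⟩
      rcases s with _ | i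
      · simp [hnone] at hs
      · exact ⟨i, by simp [hs]⟩
  · rintro ⟨f, ⟨hlt, hodd⟩, rfl⟩
    have hodd' : ∀ j, j ≤ 2 * m → Odd j → ∃ s : FBState n, s.map f = some j := by
      rintro j hj ⟨k, rfl⟩
      obtain ⟨i, hi⟩ := hodd k (by omega)
      exact ⟨some i, by simp [hi]⟩
    refine ⟨⟨?_, hm, ⟨hodd' _ (by omega) ⟨m - 1, by omega⟩, ?_⟩, hodd'⟩, by simp, rfl⟩
    · rintro (_ | i) r hr
      · simp at hr
      · have := hlt i
        simp only [Option.map_some, Option.some.injEq] at hr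
        exact ⟨by omega, fun _ => by simp [FB, full]⟩
    · rintro r ⟨_ | i, hr⟩
      · simp at hr
      · have := hlt i
        simp only [Option.map_some, Option.some.injEq] at hr
        omega

lemma qRankingCount_eq (hm : 1 ≤ m) (hmn : m < n) :
    qRankingCount n m = {f : Fin (n - 1) → ℕ | IsTight f m}.ncard := by
  rw [qRankingCount, setOf_isQRanking hm hmn, Set.ncard_image_of_injective]
  intro f g h
  funext i
  simpa using congrFun h (some i)

lemma maxQRankingCount_le_complementComplexity (n : ℕ) :
    (maxQRankingCount n : ℕ∞) ≤ (FB n).complementComplexity := by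
  refine le_iInf₂ ?_
  rintro k ⟨T, _, N, rfl, hN⟩
  refine Nat.cast_le.2 (Finset.sup_le fun m hm => ?_)
  obtain ⟨hm₁, hm₂⟩ := Finset.mem_Ico.1 hm
  rw [qRankingCount_eq hm₁ hm₂]
  exact ncard_isTight_le_card hN m

lemma complementComplexity_FB_le (hn : 1 < n) :
    (FB n).complementComplexity ≤ complementComplexityOfSize n :=
  le_sSup ⟨_, inferInstance, FBState n, inferInstance, FB n, by simp; omega, rfl⟩

end QRankings

/-! ### The exponential generating function of the number of rankings -/

section Counting

open PowerSeries

/-- The power series `exp (2 * X) - exp X`. Its `m`-th power is the exponential generating function,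
in the number of main states, of the number of tight functions with parameter `m`. -/
noncomputable def rankSeries : PowerSeries ℝ := exp ℝ ^ 2 - exp ℝ

/-- The number of tight functions with parameter `m` on `N` main states, divided by `N !`. -/
noncomputable def rankCoeff (N m : ℕ) : ℝ := coeff N (rankSeries ^ m)

lemma rankCoeff_eq_sum (N m : ℕ) :
    rankCoeff N m = ∑ j ∈ Finset.range (m + 1),
      m.choose j * ((-1) ^ j * ((2 * m - j : ℕ) : ℝ) ^ N) / N.factorial := by
  have hbin : rankSeries ^ m = ∑ j ∈ Finset.range (m + 1),
      C ((-1 : ℝ) ^ j * m.choose j) * rescale ((2 * m - j : ℕ) : ℝ) (exp ℝ) := by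
    rw [rankSeries, show exp ℝ ^ 2 - exp ℝ = -exp ℝ + exp ℝ ^ 2 by ring, add_pow]
    refine Finset.sum_congr rfl fun j hj => ?_
    have hj' : j ≤ m := by simpa [Nat.lt_succ_iff] using hj
    rw [← exp_pow_eq_rescale_exp, neg_pow, ← pow_mul,
      show 2 * m - j = j + 2 * (m - j) by omega, pow_add]
    simp only [map_mul, map_pow, map_neg, map_one, map_natCast]
    ring
  rw [rankCoeff, hbin, map_sum]
  refine Finset.sum_congr rfl fun j _ => ?_
  rw [coeff_C_mul, coeff_rescale, coeff_exp]
  simp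
  ring

/-- Inclusion–exclusion over the odd numbers that are not attained. -/
lemma ncard_isTight (N m : ℕ) :
    ({f : Fin N → ℕ | IsTight f m}.ncard : ℝ) = N.factorial * rankCoeff N m := by
  let o : Fin m → Fin (2 * m) := fun j => ⟨2 * j + 1, by omega⟩
  have ho : Function.Injective o := fun i j h => by
    have := congrArg Fin.val h
    simp only [o] at this
    exact Fin.ext (by omega)
  let s : Fin m → Finset (Fin N → Fin (2 * m)) := fun j =>
    Fintype.piFinset fun _ => Finset.univ.erase (o j)
  have himg : {f : Fin N → ℕ | IsTight f m} =
      (fun (f : Fin N → Fin (2 * m)) x => (f x : ℕ)) ''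
        (Finset.univ.inf fun j => (s j)ᶜ : Finset (Fin N → Fin (2 * m))) := by
    ext f
    constructor
    · rintro ⟨h₁, h₂⟩
      refine ⟨fun x => ⟨f x, h₁ x⟩, ?_, rfl⟩
      simp only [Finset.mem_coe, Finset.mem_inf, s, o, Finset.mem_compl, Fintype.mem_piFinset]
      intro j _ h
      obtain ⟨p, hp⟩ := h₂ j j.isLt
      simpa [hp] using h p
    · rintro ⟨f, hf, rfl⟩
      simp only [Finset.mem_coe, Finset.mem_inf, s, o, Finset.mem_compl, Fintype.mem_piFinset] at hf
      refine ⟨fun x => (f x).isLt, fun j hj => ?_⟩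
      have := hf ⟨j, hj⟩ (Finset.mem_univ _)
      simpa [Fin.ext_iff] using this
  have hinf : ∀ t : Finset (Fin m), t.inf s =
      Fintype.piFinset fun _ => Finset.univ \ t.image o := by
    intro t
    ext f
    simp only [Finset.mem_inf, s, Fintype.mem_piFinset, Finset.mem_erase, Finset.mem_sdiff,
      Finset.mem_univ, Finset.mem_image, true_and, and_true, not_exists, not_and]
    exact ⟨fun h x j hj e => h j hj x e.symm, fun h j hj x e => h x j hj e.symm⟩
  have hcard : ∀ t : Finset (Fin m), (t.inf s).card = (2 * m - t.card) ^ N := by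
    intro t
    rw [hinf, Fintype.card_piFinset]
    simp [Finset.card_sdiff, Finset.card_image_of_injective _ ho]
  have hinj : Function.Injective fun (f : Fin N → Fin (2 * m)) x => (f x : ℕ) := by
    intro f g h
    funext x
    exact Fin.ext (congrFun h x)
  have hie := Finset.inclusion_exclusion_card_inf_compl Finset.univ s
  simp only [hcard] at hie
  rw [Finset.sum_powerset_apply_card
    (fun j => (-1 : ℤ) ^ j * (((2 * m - j) ^ N : ℕ) : ℤ))] at hie
  rw [himg, Set.ncard_image_of_injective _ hinj, Set.ncard_coe_finset, rankCoeff_eq_sum,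
    Finset.mul_sum]
  have hfac : (N.factorial : ℝ) ≠ 0 := by positivity
  have hie' := congrArg (fun z : ℤ => (z : ℝ)) hie
  simp only [Int.cast_natCast, Int.cast_sum, Finset.card_univ, Fintype.card_fin] at hie'
  rw [hie']
  refine Finset.sum_congr rfl fun j _ => ?_
  push_cast
  simp only [nsmul_eq_mul, Int.cast_mul, Int.cast_natCast, Int.cast_pow, Int.cast_neg, Int.cast_one]
  field_simp

lemma coeff_rankSeries (k : ℕ) : coeff k rankSeries = (2 ^ k - 1) / k.factorial := by
  rw [rankSeries, map_sub, exp_pow_eq_rescale_exp, coeff_rescale, coeff_exp]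
  simp
  ring

lemma coeff_rankSeries_nonneg (k : ℕ) : 0 ≤ coeff k rankSeries := by
  rw [coeff_rankSeries]
  have : (1 : ℝ) ≤ 2 ^ k := one_le_pow₀ (by norm_num)
  exact div_nonneg (by linarith) (by positivity)

lemma rankCoeff_succ (N m : ℕ) : rankCoeff N (m + 1) =
    ∑ k ∈ Finset.range (N + 1), coeff k rankSeries * rankCoeff (N - k) m := by
  rw [rankCoeff, pow_succ', coeff_mul, Finset.Nat.sum_antidiagonal_eq_sum_range_succ_mk]
  rfl

lemma rankCoeff_zero_right (N : ℕ) : rankCoeff N 0 = if N = 0 then 1 else 0 := by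
  simp [rankCoeff, coeff_one]

lemma rankCoeff_nonneg (N m : ℕ) : 0 ≤ rankCoeff N m := by
  induction m generalizing N with
  | zero => rw [rankCoeff_zero_right]; split_ifs <;> norm_num
  | succ m ih =>
    rw [rankCoeff_succ]
    exact Finset.sum_nonneg fun k _ => mul_nonneg (coeff_rankSeries_nonneg k) (ih _)

/-! ### Renewal estimates for the coefficients -/

/-- The positive solution `x` of `exp (2 * x) - exp x = 1`. -/
noncomputable def growthRadius : ℝ := Real.log Real.goldenRatio

lemma exp_growthRadius : Real.exp growthRadius = Real.goldenRatio :=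
  Real.exp_log Real.goldenRatio_pos

lemma growthRadius_pos : 0 < growthRadius := Real.log_pos Real.one_lt_goldenRatio

lemma exp_two_mul_growthRadius : Real.exp (2 * growthRadius) - Real.exp growthRadius = 1 := by
  rw [two_mul, Real.exp_add, exp_growthRadius]
  linarith [Real.goldenRatio_sq, sq Real.goldenRatio]

lemma two_mul_growthRadius_le_one : 2 * growthRadius ≤ 1 := by
  rw [← Real.exp_le_exp]
  have h₁ := exp_two_mul_growthRadius
  have h₂ := Real.exp_one_gt_d9
  have h₃ : Real.goldenRatio < 1.7 := by
    have := Real.goldenRatio_sq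
    have := Real.goldenRatio_pos
    nlinarith
  rw [exp_growthRadius] at h₁
  linarith

lemma hasSum_exp (x : ℝ) : HasSum (fun n : ℕ => x ^ n / n.factorial) (Real.exp x) := by
  rw [Real.exp_eq_exp_ℝ]
  exact NormedSpace.expSeries_div_hasSum_exp x

/-- The numbers `coeff k rankSeries * growthRadius ^ k` form a probability distribution. -/
lemma sum_coeff_rankSeries_le_one (N : ℕ) :
    ∑ k ∈ Finset.range (N + 1), coeff k rankSeries * growthRadius ^ k ≤ 1 := by
  have h := (hasSum_exp (2 * growthRadius)).sub (hasSum_exp growthRadius)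
  rw [exp_two_mul_growthRadius] at h
  have e : (fun k : ℕ => (2 * growthRadius) ^ k / k.factorial - growthRadius ^ k / k.factorial) =
      fun k => coeff k rankSeries * growthRadius ^ k := by
    funext k
    rw [coeff_rankSeries, mul_pow]
    ring
  rw [e] at h
  exact sum_le_hasSum _
    (fun k _ => mul_nonneg (coeff_rankSeries_nonneg k) (pow_nonneg growthRadius_pos.le k)) h

lemma le_sum_coeff_rankSeries {N : ℕ} (hN : 1 ≤ N) :
    (N : ℝ) / (N + 3) ≤ ∑ k ∈ Finset.range (N + 1), coeff k rankSeries * growthRadius ^ k := by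
  have hρ := growthRadius_pos
  have h₁ := Real.exp_bound' (by positivity) two_mul_growthRadius_le_one (Nat.succ_pos N)
  have h₂ := Real.sum_le_exp_of_nonneg hρ.le (N + 1)
  have e : ∑ k ∈ Finset.range (N + 1), coeff k rankSeries * growthRadius ^ k =
      ∑ k ∈ Finset.range (N + 1), (2 * growthRadius) ^ k / k.factorial -
        ∑ k ∈ Finset.range (N + 1), growthRadius ^ k / k.factorial := by
    rw [← Finset.sum_sub_distrib]
    refine Finset.sum_congr rfl fun k _ => ?_
    rw [coeff_rankSeries, mul_pow]
    ring
  have h₃ : (2 * growthRadius) ^ N.succ * ((N.succ : ℝ) + 1) / (N.succ.factorial * N.succ) ≤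
      3 / (N + 3) := by
    have hpow : (2 * growthRadius) ^ N.succ ≤ 1 :=
      pow_le_one₀ (by positivity) two_mul_growthRadius_le_one
    have hN' : (1 : ℝ) ≤ N := by exact_mod_cast hN
    have hfac : 2 * (N : ℝ) ≤ N.succ.factorial := by
      have : 2 * N ≤ N.succ.factorial := by
        rw [Nat.factorial_succ]
        exact Nat.mul_le_mul (by omega) N.self_le_factorial
      exact_mod_cast this
    rw [div_le_div_iff₀ (by positivity) (by positivity)]
    push_cast
    calc (2 * growthRadius) ^ N.succ * ((N : ℝ) + 1 + 1) * (N + 3)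
        ≤ 1 * ((N : ℝ) + 1 + 1) * (N + 3) := by gcongr
      _ ≤ 3 * (2 * (N : ℝ) * (N + 1)) := by nlinarith
      _ ≤ 3 * (N.succ.factorial * ((N : ℝ) + 1)) := by gcongr
  have h₄ : (N : ℝ) / (N + 3) = 1 - 3 / (N + 3) := by field_simp; ring
  have h₅ := exp_two_mul_growthRadius
  simp only [Nat.succ_eq_add_one] at h₁ h₃
  linarith

lemma rankCoeff_mul_pow_le_one (N m : ℕ) : rankCoeff N m * growthRadius ^ N ≤ 1 := by
  induction m generalizing N with
  | zero => rw [rankCoeff_zero_right]; split_ifs with h <;> simp [h]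
  | succ m ih =>
    rw [rankCoeff_succ, Finset.sum_mul]
    refine le_trans (Finset.sum_le_sum fun k hk => ?_) (sum_coeff_rankSeries_le_one N)
    have hk' : k ≤ N := by simpa [Nat.lt_succ_iff] using hk
    calc coeff k rankSeries * rankCoeff (N - k) m * growthRadius ^ N
        = coeff k rankSeries * growthRadius ^ k *
          (rankCoeff (N - k) m * growthRadius ^ (N - k)) := by
          rw [← pow_mul_pow_sub growthRadius hk']; ring
      _ ≤ coeff k rankSeries * growthRadius ^ k * 1 := by
          have := coeff_rankSeries_nonneg k
          have := growthRadius_pos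
          gcongr
          exact ih _
      _ = _ := mul_one _

/-- The coefficient of `X ^ N` in `∑ m, rankSeries ^ m`. -/
noncomputable def rankCoeffSum (N : ℕ) : ℝ := ∑ m ∈ Finset.range (N + 1), rankCoeff N m

lemma le_rankCoeffSum {N : ℕ} (hN : 1 ≤ N) :
    ∑ k ∈ Finset.range (N + 1), coeff k rankSeries * rankCoeffSum (N - k) ≤ rankCoeffSum N := by
  have e : rankCoeffSum N = ∑ k ∈ Finset.range (N + 1), coeff k rankSeries *
      ∑ m ∈ Finset.range N, rankCoeff (N - k) m := by
    rw [rankCoeffSum, Finset.sum_range_succ', rankCoeff_zero_right, if_neg (by omega), add_zero]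
    simp only [rankCoeff_succ, Finset.mul_sum]
    exact Finset.sum_comm
  rw [e]
  refine Finset.sum_le_sum fun k _ => ?_
  rcases Nat.eq_zero_or_pos k with rfl | hk
  · simp [coeff_rankSeries]
  · refine mul_le_mul_of_nonneg_left ?_ (coeff_rankSeries_nonneg k)
    refine Finset.sum_le_sum_of_subset_of_nonneg ?_ fun m _ _ => rankCoeff_nonneg _ _
    exact Finset.range_subset_range.2 (by omega)

/-- The renewal inequality loses only the factor `N / (N + 3)` in each step. -/
lemma le_rankCoeffSum_mul_pow (N : ℕ) :
    6 / (((N : ℝ) + 1) * (N + 2) * (N + 3)) ≤ rankCoeffSum N * growthRadius ^ N := by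
  induction N using Nat.strong_induction_on with
  | _ N ih =>
    rcases Nat.eq_zero_or_pos N with rfl | hN
    · simp [rankCoeffSum, rankCoeff_zero_right]
      norm_num
    have hρ := growthRadius_pos
    have hN' : (1 : ℝ) ≤ N := by exact_mod_cast hN
    set l : ℝ := 6 / ((N : ℝ) * (N + 1) * (N + 2)) with hl
    have hl0 : 0 ≤ l := by positivity
    calc 6 / (((N : ℝ) + 1) * (N + 2) * (N + 3)) = N / (N + 3) * l := by
          rw [hl]; field_simp
      _ ≤ (∑ k ∈ Finset.range (N + 1), coeff k rankSeries * growthRadius ^ k) * l :=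
          mul_le_mul_of_nonneg_right (le_sum_coeff_rankSeries hN) hl0
      _ ≤ ∑ k ∈ Finset.range (N + 1),
            coeff k rankSeries * rankCoeffSum (N - k) * growthRadius ^ N := by
          rw [Finset.sum_mul]
          refine Finset.sum_le_sum fun k hk => ?_
          have hk' : k ≤ N := by simpa [Nat.lt_succ_iff] using hk
          rcases Nat.eq_zero_or_pos k with rfl | hk0
          · simp [coeff_rankSeries]
          have hw := coeff_rankSeries_nonneg k
          have hkN : ((N - k : ℕ) : ℝ) + 1 ≤ N := by
            have : N - k + 1 ≤ N := by omega
            exact_mod_cast this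
          have hmono : l ≤ rankCoeffSum (N - k) * growthRadius ^ (N - k) := by
            refine le_trans ?_ (ih (N - k) (by omega))
            rw [hl]
            refine div_le_div_of_nonneg_left (by norm_num) (by positivity) ?_
            exact mul_le_mul (mul_le_mul hkN (by linarith) (by positivity) (by positivity))
              (by linarith) (by positivity) (by positivity)
          calc coeff k rankSeries * growthRadius ^ k * l
              ≤ coeff k rankSeries * growthRadius ^ k *
                (rankCoeffSum (N - k) * growthRadius ^ (N - k)) := by gcongr
            _ = _ := by rw [← pow_mul_pow_sub growthRadius hk']; ring
      _ = (∑ k ∈ Finset.range (N + 1), coeff k rankSeries * rankCoeffSum (N - k)) *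
            growthRadius ^ N := by rw [Finset.sum_mul]
      _ ≤ rankCoeffSum N * growthRadius ^ N :=
          mul_le_mul_of_nonneg_right (le_rankCoeffSum hN) (by positivity)

end Counting

/-! ### The growth of `L(n)` -/

section Growth

/-- The constant `c`, where `log φ` is the radius of convergence of `∑ m, rankSeries ^ m`, and
Stirling's formula for the factorial contributes `exp 1`. -/
noncomputable def growthConst : ℝ := 1 / (Real.exp 1 * growthRadius)

lemma growthRadius_bounds : 0.48118 < growthRadius ∧ growthRadius < 0.48123 := by
  have h₁ := Real.goldenRatio_sq
  have h₂ := Real.goldenRatio_pos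
  have hlo : 1.61803 < Real.goldenRatio := by nlinarith
  have hhi : Real.goldenRatio < 1.61804 := by nlinarith
  constructor
  · rw [growthRadius, Real.lt_log_iff_exp_lt h₂]
    refine lt_of_le_of_lt (Real.exp_bound' (n := 8) (by norm_num) (by norm_num) (by norm_num)) ?_
    refine lt_trans ?_ hlo
    norm_num [Finset.sum_range_succ, Nat.factorial]
  · rw [growthRadius, Real.log_lt_iff_lt_exp h₂]
    refine lt_of_lt_of_le ?_ (Real.sum_le_exp_of_nonneg (by norm_num) 8)
    refine lt_trans hhi ?_
    norm_num [Finset.sum_range_succ, Nat.factorial]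

lemma growthConst_bounds : 0.76445 < growthConst ∧ growthConst < 0.76455 := by
  obtain ⟨h₁, h₂⟩ := growthRadius_bounds
  have h₃ := Real.exp_one_gt_d9
  have h₄ := Real.exp_one_lt_d9
  have hpos : 0 < Real.exp 1 * growthRadius := by positivity
  rw [growthConst, lt_div_iff₀ hpos, div_lt_iff₀ hpos]
  constructor
  · calc 0.76445 * (Real.exp 1 * growthRadius)
        ≤ 0.76445 * (2.7182818286 * 0.48123) := by gcongr
      _ < 1 := by norm_num
  · calc (1 : ℝ) < 0.76455 * (2.7182818283 * 0.48118) := by norm_num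
      _ ≤ 0.76455 * (Real.exp 1 * growthRadius) := by gcongr

lemma pow_div_exp_le_factorial (n : ℕ) : ((n : ℝ) / Real.exp 1) ^ n ≤ n.factorial := by
  have h := Real.pow_div_factorial_le_exp (n : ℝ) (by positivity) n
  rw [div_le_iff₀ (by positivity)] at h
  rw [div_pow, ← Real.exp_nat_mul, mul_one, div_le_iff₀ (Real.exp_pos _)]
  linarith

lemma factorial_le_exp_mul_pow (N : ℕ) :
    (N.factorial : ℝ) ≤ Real.exp 1 * (((N + 1 : ℕ) : ℝ) / Real.exp 1) ^ (N + 1) := by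
  induction N with
  | zero => simp
  | succ N ih =>
    have hx : (0 : ℝ) < ((N + 1 : ℕ) : ℝ) := by positivity
    set x : ℝ := ((N + 1 : ℕ) : ℝ) with hxdef
    have hx1 : ((N + 1 + 1 : ℕ) : ℝ) = x + 1 := by rw [hxdef]; push_cast; ring
    -- `exp 1 ≤ (1 + 1 / x) ^ (x + 1)`
    have hexp : Real.exp 1 * x ^ (N + 1 + 1) ≤ (x + 1) ^ (N + 1 + 1) := by
      have h := Real.one_sub_inv_le_log_of_pos (x := (x + 1) / x) (by positivity)
      have h' : Real.exp (1 / (x + 1)) ≤ (x + 1) / x := by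
        rw [← Real.le_log_iff_exp_le (by positivity)]
        refine le_trans (le_of_eq ?_) h
        field_simp
        ring
      have h'' : Real.exp 1 ≤ ((x + 1) / x) ^ (N + 1 + 1) := by
        refine le_trans (le_of_eq ?_) (pow_le_pow_left₀ (Real.exp_pos _).le h' (N + 1 + 1))
        rw [← Real.exp_nat_mul, hx1]
        congr 1
        field_simp
      rw [div_pow, le_div_iff₀ (by positivity)] at h''
      exact h''
    have he := Real.exp_pos 1
    calc ((N + 1).factorial : ℝ) = x * N.factorial := by
          rw [Nat.factorial_succ]; push_cast [hxdef]; ring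
      _ ≤ x * (Real.exp 1 * (x / Real.exp 1) ^ (N + 1)) := by gcongr
      _ = Real.exp 1 * (Real.exp 1 * x ^ (N + 1 + 1) / Real.exp 1 ^ (N + 1 + 1)) := by
          rw [div_pow]; field_simp; ring
      _ ≤ Real.exp 1 * ((x + 1) ^ (N + 1 + 1) / Real.exp 1 ^ (N + 1 + 1)) := by gcongr
      _ = _ := by rw [hx1, div_pow]

lemma qRankingCount_eq_rankCoeff {N m : ℕ} (hm : 1 ≤ m) (hmN : m ≤ N) :
    (qRankingCount (N + 1) m : ℝ) = N.factorial * rankCoeff N m := by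
  rw [qRankingCount_eq hm (by omega)]
  exact ncard_isTight N m

lemma maxQRankingCount_mul_pow_le {N : ℕ} (hN : 1 ≤ N) :
    (maxQRankingCount (N + 1) : ℝ) * growthRadius ^ N ≤ N.factorial := by
  obtain ⟨m, hm, h⟩ := Finset.exists_mem_eq_sup (Finset.Ico 1 (N + 1))
    (Finset.nonempty_Ico.2 (by omega)) (qRankingCount (N + 1))
  obtain ⟨hm₁, hm₂⟩ := Finset.mem_Ico.1 hm
  rw [maxQRankingCount, h, qRankingCount_eq_rankCoeff hm₁ (by omega), mul_assoc]
  exact mul_le_of_le_one_right (by positivity) (rankCoeff_mul_pow_le_one N m)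

lemma factorial_le_maxQRankingCount_mul {N : ℕ} (hN : 1 ≤ N) :
    (N.factorial : ℝ) * (6 / (((N : ℝ) + 1) * (N + 2) * (N + 3))) ≤
      N * maxQRankingCount (N + 1) * growthRadius ^ N := by
  have hsum : N.factorial * rankCoeffSum N ≤ N * maxQRankingCount (N + 1) := by
    rw [rankCoeffSum, Finset.sum_range_succ', rankCoeff_zero_right, if_neg (by omega), add_zero,
      Finset.mul_sum]
    refine (Finset.sum_le_card_nsmul _ _ (maxQRankingCount (N + 1) : ℝ) fun m hm => ?_).trans
      (by simp)
    have hm' := Finset.mem_range.1 hm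
    rw [← qRankingCount_eq_rankCoeff (by omega) (by omega)]
    exact_mod_cast Finset.le_sup (f := qRankingCount (N + 1))
      (Finset.mem_Ico.2 ⟨by omega, by omega⟩)
  calc _ ≤ N.factorial * (rankCoeffSum N * growthRadius ^ N) := by
        gcongr
        exact le_rankCoeffSum_mul_pow N
    _ = N.factorial * rankCoeffSum N * growthRadius ^ N := by ring
    _ ≤ _ := mul_le_mul_of_nonneg_right hsum (pow_nonneg growthRadius_pos.le N)

lemma growthConst_mul_pow (n : ℕ) :
    (growthConst * n) ^ n * growthRadius ^ n = ((n : ℝ) / Real.exp 1) ^ n := by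
  rw [← mul_pow]
  have := growthRadius_pos
  congr 1
  rw [growthConst]
  field_simp

lemma growthConst_mul_pow_le {n : ℕ} (hn : 1 < n) :
    (growthConst * n) ^ n ≤ (n : ℝ) ^ 5 * maxQRankingCount n := by
  obtain ⟨N, rfl⟩ : ∃ N, n = N + 1 := ⟨n - 1, by omega⟩
  have hN : 1 ≤ N := by omega
  have hρ := growthRadius_pos
  have hN' : (1 : ℝ) ≤ N := by exact_mod_cast hN
  have hρ' := growthRadius_bounds.1
  refine le_of_mul_le_mul_right ?_ (pow_pos hρ (N + 1))
  rw [growthConst_mul_pow]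
  refine (pow_div_exp_le_factorial (N + 1)).trans ?_
  have h := factorial_le_maxQRankingCount_mul hN
  rw [← mul_div_assoc, div_le_iff₀ (by positivity)] at h
  set P : ℝ := maxQRankingCount (N + 1) * growthRadius ^ N with hP
  have hP0 : 0 ≤ P := by positivity
  have h' : (N.factorial : ℝ) * 6 ≤ P * (N * ((N + 1) * (N + 2) * (N + 3))) := by
    rw [hP]; linarith
  calc ((N + 1).factorial : ℝ) = ((N : ℝ) + 1) * (N.factorial * 6) / 6 := by
        rw [Nat.factorial_succ]; push_cast; ring
    _ ≤ ((N : ℝ) + 1) * (P * (N * ((N + 1) * (N + 2) * (N + 3)))) / 6 := by gcongr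
    _ = P * (((N : ℝ) + 1) ^ 2 * (N * (N + 2) * (N + 3)) / 6) := by ring
    _ ≤ P * (((N : ℝ) + 1) ^ 2 * (((N : ℝ) + 1) ^ 3 * 2) / 6) := by
        have : (N : ℝ) * (N + 2) * (N + 3) ≤ ((N : ℝ) + 1) ^ 3 * 2 := by
          nlinarith [pow_nonneg (zero_le_one.trans hN') 3]
        gcongr
    _ ≤ P * (((N : ℝ) + 1) ^ 5 * growthRadius) := by
        have : (0 : ℝ) ≤ ((N : ℝ) + 1) ^ 5 := by positivity
        gcongr
        nlinarith
    _ = _ := by rw [hP]; push_cast; ring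

lemma maxQRankingCount_le {n : ℕ} (hn : 1 < n) :
    (maxQRankingCount n : ℝ) ≤ (n : ℝ) ^ 5 * (growthConst * n) ^ n := by
  obtain ⟨N, rfl⟩ : ∃ N, n = N + 1 := ⟨n - 1, by omega⟩
  have hN : 1 ≤ N := by omega
  have hρ := growthRadius_pos
  refine le_of_mul_le_mul_right ?_ (pow_pos hρ (N + 1))
  rw [mul_assoc, growthConst_mul_pow]
  have hK : 0 ≤ (((N + 1 : ℕ) : ℝ) / Real.exp 1) ^ (N + 1) := by positivity
  have hN' : (2 : ℝ) ≤ ((N + 1 : ℕ) : ℝ) := by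
    have : 2 ≤ N + 1 := by omega
    exact_mod_cast this
  have hconst : growthRadius * Real.exp 1 ≤ ((N + 1 : ℕ) : ℝ) ^ 5 := by
    have h₁ := Real.exp_one_lt_d9
    have h₂ := two_mul_growthRadius_le_one
    have h₃ := Real.exp_pos 1
    have h₄ := pow_le_pow_left₀ (by norm_num) hN' 5
    nlinarith
  calc (maxQRankingCount (N + 1) : ℝ) * growthRadius ^ (N + 1)
      = growthRadius * (maxQRankingCount (N + 1) * growthRadius ^ N) := by ring
    _ ≤ growthRadius * N.factorial := by gcongr; exact maxQRankingCount_mul_pow_le hN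
    _ ≤ growthRadius * (Real.exp 1 * (((N + 1 : ℕ) : ℝ) / Real.exp 1) ^ (N + 1)) := by
        gcongr; exact factorial_le_exp_mul_pow N
    _ = growthRadius * Real.exp 1 * (((N + 1 : ℕ) : ℝ) / Real.exp 1) ^ (N + 1) := by ring
    _ ≤ _ := mul_le_mul_of_nonneg_right hconst hK

/-- As `0.76 < growthConst`, the polynomial factor is absorbed by a geometric sequence. -/
lemma isBigO_maxQRankingCount :
    (fun n : ℕ => (0.76 * (n : ℝ)) ^ n) =O[atTop] (fun n : ℕ => (maxQRankingCount n : ℝ)) := by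
  have hc := growthConst_bounds.1
  have hc0 : 0 < growthConst := by linarith
  have hr : |0.76 / growthConst| < 1 := by
    rw [abs_of_pos (by positivity), div_lt_one hc0]
    linarith
  have hlim := tendsto_pow_const_mul_const_pow_of_abs_lt_one 5 hr
  refine IsBigO.of_bound 1 ?_
  filter_upwards [hlim.eventually_le_const one_pos, eventually_gt_atTop 1] with n h₁ hn
  rw [Real.norm_of_nonneg (by positivity), Real.norm_of_nonneg (by positivity)]
  calc (0.76 * (n : ℝ)) ^ n = (0.76 / growthConst) ^ n * (growthConst * n) ^ n := by
        rw [← mul_pow]; congr 1; field_simp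
    _ ≤ (0.76 / growthConst) ^ n * ((n : ℝ) ^ 5 * maxQRankingCount n) := by
        gcongr
        exact growthConst_mul_pow_le hn
    _ = (n : ℝ) ^ 5 * (0.76 / growthConst) ^ n * maxQRankingCount n := by ring
    _ ≤ 1 * maxQRankingCount n := by gcongr

end Growth

end NBW

theorem mainTheorem1 :
    (∀ n : ℕ, 1 < n →
      (NBW.maxQRankingCount n : ℕ∞) ≤ (NBW.FB n).complementComplexity ∧
      (NBW.FB n).complementComplexity ≤ NBW.complementComplexityOfSize n) ∧
    (fun n : ℕ => (0.76 * (n : ℝ)) ^ n) =O[atTop]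
      (fun n : ℕ => (NBW.maxQRankingCount n : ℝ)) ∧
    ∃ c : ℝ, |c - 0.7645| < 0.00005 ∧ ∃ d : ℕ, ∀ n : ℕ, 1 < n →
      (c * (n : ℝ)) ^ n ≤ (n : ℝ) ^ d * (NBW.maxQRankingCount n : ℝ) ∧
      (NBW.maxQRankingCount n : ℝ) ≤ (n : ℝ) ^ d * (c * (n : ℝ)) ^ n := by
  refine ⟨fun n hn => ⟨NBW.maxQRankingCount_le_complementComplexity n,
    NBW.complementComplexity_FB_le hn⟩, NBW.isBigO_maxQRankingCount, NBW.growthConst, ?_, 5,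
    fun n hn => ⟨NBW.growthConst_mul_pow_le hn, NBW.maxQRankingCount_le hn⟩⟩
  obtain ⟨h₁, h₂⟩ := NBW.growthConst_bounds
  rw [abs_lt]
  constructor <;> linarith
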